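/- \textbf{Data model.} Let $Y$ be a countable set of labels, $(D_y)_{y\in Y}$ a probability distribution on $Y$, and $d,m\in\mathbb N$. For $y\in Y$ let $\mathcal N_y$ be the law on $\mathbb R^d$ of a vector with independent coordinates $x_i\sim\mathcal N(\mu_{y,i},\sigma_{y,i}^2)$, where $\mu_{y,i}\in\mathbb R$ and $0\le\sigma_{y,i}\le\sigma$ for all $y,i$, with a constant $\sigma$. Let $D$ be the law of $(x,y)$ when $y$ is drawn from $(D_y)$ and then $x\sim\mathcal N_y$. The training set is $S=((x_1,y_1),\dots,(x_m,y_m))\sim D^m$. \textbf{Loss.} Let $W$ be a measurable space and let $\ell:W\times\mathbb R^d\times Y\to[0,\infty)$ be measurable, with $x\mapsto\ell(w,x,y)$ continuously differentiable for all $w,y$. Put $L_D(w)=\mathbb E_{(x,y)\sim D}\,\ell(w,x,y)$ and $L_S(w)=\frac1m\sum_{i=1}^m\ell(w,x_i,y_i)$. Assume that there are constants $b,g\in\mathbb R$ such that, for every $w\in W$, $$\mathbb E_{D}\,\ell(w,x,y)\le b,\qquad \mathbb E_{D}\,\|\nabla_x\ell(w,x,y)\|^2\le g .$$ Let $0<\lambda\le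 m$ and $\delta\in(0,1)$, and assume that the loss is balanced over the labels: for every $w\in W$ and every $\alpha\in[0,\lambda/m]$, the value of $\mathbb E_{x\sim\mathcal N_y}\big[e^{-\alpha\ell(w,x,y)}\big]$ is the same for all $y\in Y$. \textbf{Conclusion.} For every probability measure $p$ on $W$ (the prior), with probability at least $1-\delta$ over the draw of $S\sim D^m$, the following holds simultaneously for all probability measures $q$ on $W$ (the posteriors): $$\mathbb E_{w\sim q}[L_D(w)]\;\le\;\mathbb E_{w\sim q}[L_S(w)]+\frac{1}{\lambda}\left(\frac{\lambda^2e^{b}g\,\sigma^2}{2m}+\mathrm{KL}(q\,\|\,p)+\log\frac1\delta\right),$$ where $\mathrm{KL}$ is the Kullback--Leibler divergence and both $\mathbb E_{w\sim q}[L_S(w)]$ and $\mathrm{KL}(q\|p)$ may be $+\infty$. -/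

import Mathlib

open MeasureTheory ProbabilityTheory InformationTheory
open scoped NNReal ENNReal

/-- The law on `ℝ^d` of independent coordinates `x_i ∼ N(μ_i, σ_i²)`; here `σ_i` is the standard
deviation. -/
noncomputable def diagGaussian {d : ℕ} (μ : Fin d → ℝ) (σ : Fin d → ℝ≥0) :
    Measure (EuclideanSpace ℝ (Fin d)) :=
  (Measure.pi fun i => gaussianReal (μ i) (σ i ^ 2)).map (WithLp.toLp 2)

instance {d : ℕ} (μ : Fin d → ℝ) (σ : Fin d → ℝ≥0) :
    IsProbabilityMeasure (diagGaussian μ σ) :=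
  Measure.isProbabilityMeasure_map (WithLp.measurable_toLp 2 _).aemeasurable

/-- The law of `(x, y)` when the label `y` has law `P` and, given `y`, the instance `x` has the
Gaussian law `N(μ_y, σ_y²)`. -/
noncomputable def gaussianMixture {d : ℕ} {Y : Type*} [MeasurableSpace Y] (P : PMF Y)
    (μ : Y → Fin d → ℝ) (σ : Y → Fin d → ℝ≥0) : Measure (EuclideanSpace ℝ (Fin d) × Y) :=
  Measure.sum fun y => P y • (diagGaussian (μ y) (σ y)).map fun x => (x, y)

instance {d : ℕ} {Y : Type*} [MeasurableSpace Y] (P : PMF Y)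
    (μ : Y → Fin d → ℝ) (σ : Y → Fin d → ℝ≥0) :
    IsProbabilityMeasure (gaussianMixture P μ σ) := by
  constructor
  have h : ∀ y, ((diagGaussian (μ y) (σ y)).map fun x => (x, y)) Set.univ = 1 := fun y =>
    (Measure.isProbabilityMeasure_map (by fun_prop)).measure_univ
  simp [gaussianMixture, Measure.sum_apply _ MeasurableSet.univ, h, P.tsum_coe]

/-- The risk `L_D(w) = E_{(x,y)∼D} ℓ(w,x,y)`. -/
noncomputable def risk {W X Y : Type*} [MeasurableSpace X] [MeasurableSpace Y]
    (ℓ : W → X → Y → ℝ) (D : Measure (X × Y)) (w : W) : ℝ :=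
  ∫ z, ℓ w z.1 z.2 ∂D

/-- The empirical risk `L_S(w) = (1/m) ∑ i, ℓ(w,x_i,y_i)`. -/
noncomputable def empiricalRisk {W X Y : Type*} {m : ℕ}
    (ℓ : W → X → Y → ℝ) (S : Fin m → X × Y) (w : W) : ℝ :=
  (1 / (m : ℝ)) * ∑ i, ℓ w (S i).1 (S i).2

/-! Fix `w`, write X for the loss as a function of (x, y), and put α = λ/m. The core is a bound on
the exponential moment of α(E X - X) under D. Since X ≥ 0 and α ≤ 1, this exponent never exceeds E X
≤ b, and below such a ceiling the exponential is dominated by a quadratic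
(`exp_le_one_add_add_sq_mul_exp`). The linear term averages to zero, so a variance bound suffices
(`integral_exp_mul_integral_sub_le`).

The variance of X consists of a within-label and a between-label part. Balance removes the latter:
the slope at 0 of a label's Laplace transform is minus its mean loss, so all labels of positive
weight share one mean (`tendsto_one_sub_integral_exp_neg_mul_div`). Within a label the Gaussian
Poincaré inequality applies (`evariance_diagGaussian_le`), and averaging over labels gives Var X ≤
σ²g. Variances live in [0, ∞] because only integrability of X is assumed; Poincaré itself supplies
square integrability.

Independence multiplies the m moments into exp(λ²e^b gσ²/(2m)). Averaging over the prior and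
applying Markov's inequality gives an event that does not depend on the posterior; on it,
Donsker-Varadhan (`integral_le_toReal_klDiv_add_log`) handles all posteriors at once. -/

/-! ### Extended-real variance and its tensorization. -/

/-- The extended-real bias-variance decomposition, valid for integrable functions. -/
theorem lintegral_ofReal_sub_sq {Ω : Type*} [MeasurableSpace Ω] {μ : Measure Ω}
    [IsProbabilityMeasure μ] {f : Ω → ℝ} (hf : Integrable f μ) (c : ℝ) :
    ∫⁻ x, ENNReal.ofReal ((f x - c) ^ 2) ∂μ
      = eVar[f; μ] + ENNReal.ofReal ((∫ x, f x ∂μ - c) ^ 2) := by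
  rw [evariance_eq_lintegral_ofReal]
  set a := ∫ x, f x ∂μ with ha
  have hsm : ∀ c : ℝ, AEStronglyMeasurable (fun x => (f x - c) ^ 2) μ := fun c =>
    (hf.aestronglyMeasurable.sub aestronglyMeasurable_const).pow 2
  have hlin : Integrable (fun x => 2 * (a - c) * (f x - a)) μ :=
    (hf.sub (integrable_const a)).const_mul _
  have hexp : ∀ x, (f x - c) ^ 2 = (f x - a) ^ 2 + 2 * (a - c) * (f x - a) + (a - c) ^ 2 := by
    intro x; ring
  by_cases h : Integrable (fun x => (f x - a) ^ 2) μ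
  · have h' : Integrable (fun x => (f x - c) ^ 2) μ := by
      simp_rw [hexp]
      exact (h.add hlin).add (integrable_const _)
    rw [← ofReal_integral_eq_lintegral_ofReal h' (.of_forall fun x => sq_nonneg _),
      ← ofReal_integral_eq_lintegral_ofReal h (.of_forall fun x => sq_nonneg _),
      ← ENNReal.ofReal_add (integral_nonneg fun x => sq_nonneg _) (sq_nonneg _)]
    congr 1
    have hadd : Integrable (fun x => (f x - a) ^ 2 + 2 * (a - c) * (f x - a)) μ := h.add hlin
    simp_rw [hexp]
    rw [integral_add hadd (integrable_const _), integral_add h hlin,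
      integral_const_mul, integral_sub hf (integrable_const _)]
    simp [← ha]
  -- The two squares differ by an integrable function, so both fail to be integrable and both sides
  -- are infinite.
  · have h' : ¬ Integrable (fun x => (f x - c) ^ 2) μ := by
      intro h'
      apply h
      have := (h'.sub hlin).sub (integrable_const ((a - c) ^ 2))
      refine this.congr (.of_forall fun x => ?_)
      simp only [Pi.sub_apply]
      rw [hexp]; ring
    have e1 := (lintegral_ofReal_ne_top_iff_integrable (hsm c)
      (.of_forall fun x => sq_nonneg _)).not.mpr h'
    have e2 := (lintegral_ofReal_ne_top_iff_integrable (hsm a)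
      (.of_forall fun x => sq_nonneg _)).not.mpr h
    rw [not_not] at e1 e2
    simp [e1, e2]

theorem ofReal_integral_sq_le {Ω : Type*} [MeasurableSpace Ω] {μ : Measure Ω}
    [IsProbabilityMeasure μ] {f : Ω → ℝ} (hf : Integrable f μ) :
    ENNReal.ofReal ((∫ x, f x ∂μ) ^ 2) ≤ ∫⁻ x, ENNReal.ofReal (f x ^ 2) ∂μ := by
  have := lintegral_ofReal_sub_sq hf 0
  simp only [sub_zero] at this
  rw [this]
  exact le_add_self

/-- Two independent copies eliminate the mean, so that only increments of `f` need to be estimated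
in the Poincaré inequality. -/
theorem lintegral_lintegral_ofReal_sub_sq {Ω : Type*} [MeasurableSpace Ω] {μ : Measure Ω}
    [IsProbabilityMeasure μ] {f : Ω → ℝ} (hf : Integrable f μ) :
    ∫⁻ y, ∫⁻ x, ENNReal.ofReal ((f x - f y) ^ 2) ∂μ ∂μ = 2 * eVar[f; μ] := by
  simp_rw [lintegral_ofReal_sub_sq hf]
  rw [lintegral_add_left measurable_const, two_mul, lintegral_const, measure_univ, mul_one,
    evariance_eq_lintegral_ofReal]
  congr 1
  exact lintegral_congr fun x => by rw [sub_sq_comm]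

/-- Tensorization of the variance over a product of probability spaces. -/
theorem evariance_prod_le {α β : Type*} [MeasurableSpace α] [MeasurableSpace β]
    {μ : Measure α} {ν : Measure β} [IsProbabilityMeasure μ] [IsProbabilityMeasure ν]
    {f : α × β → ℝ} (hfm : Measurable f) (hf : Integrable f (μ.prod ν)) :
    eVar[f; μ.prod ν] ≤ ∫⁻ x, eVar[fun y => f (x, y); ν] ∂μ
      + ∫⁻ y, eVar[fun x => f (x, y); μ] ∂ν := by
  set a := ∫ z, f z ∂μ.prod ν with ha
  have hg : Measurable fun x => ∫ y, f (x, y) ∂ν :=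
    hfm.stronglyMeasurable.integral_prod_right'.measurable
  have hh : Measurable fun y => ∫ x, f (x, y) ∂μ :=
    hfm.stronglyMeasurable.integral_prod_left'.measurable
  have h1 : eVar[f; μ.prod ν] = ∫⁻ x, eVar[fun y => f (x, y); ν] ∂μ
      + ∫⁻ x, ENNReal.ofReal ((∫ y, f (x, y) ∂ν - a) ^ 2) ∂μ := by
    rw [evariance_eq_lintegral_ofReal, lintegral_prod _ (by fun_prop),
      ← lintegral_add_right _ (by fun_prop)]
    refine lintegral_congr_ae ?_
    filter_upwards [hf.prod_right_ae] with x hx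
    exact lintegral_ofReal_sub_sq hx a
  rw [h1]
  gcongr
  -- The centred conditional mean is the `ν`-average of `f` minus its mean in the first variable;
  -- Jensen and then Tonelli leave the variances in that variable.
  calc ∫⁻ x, ENNReal.ofReal ((∫ y, f (x, y) ∂ν - a) ^ 2) ∂μ
      ≤ ∫⁻ x, ∫⁻ y, ENNReal.ofReal ((f (x, y) - ∫ x', f (x', y) ∂μ) ^ 2) ∂ν ∂μ := by
        refine lintegral_mono_ae ?_
        filter_upwards [hf.prod_right_ae] with x hx
        have hhi : Integrable (fun y => ∫ x', f (x', y) ∂μ) ν := hf.integral_prod_right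
        have : ∫ y, f (x, y) ∂ν - a = ∫ y, (f (x, y) - ∫ x', f (x', y) ∂μ) ∂ν := by
          rw [integral_sub hx hhi, ha, integral_prod_symm _ hf]
        rw [this]
        exact ofReal_integral_sq_le (hx.sub hhi)
    _ = ∫⁻ y, ∫⁻ x, ENNReal.ofReal ((f (x, y) - ∫ x', f (x', y) ∂μ) ^ 2) ∂μ ∂ν := by
        refine lintegral_lintegral_swap (Measurable.aemeasurable ?_)
        have : Measurable fun z : α × β => ∫ x', f (x', z.2) ∂μ := hh.comp measurable_snd
        exact ((hfm.sub this).pow_const 2).ennreal_ofReal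
    _ = ∫⁻ y, eVar[fun x => f (x, y); μ] ∂ν := by
        simp_rw [evariance_eq_lintegral_ofReal]

/-! ### The Gaussian Poincaré inequality on the line. -/

/-- Cauchy-Schwarz for the fundamental theorem of calculus, read off from the nonnegative integral
of (f' - m)², with m the mean slope. -/
theorem sq_sub_le_mul_integral_deriv_sq {f : ℝ → ℝ} (hf : ContDiff ℝ 1 f) {x y : ℝ} (h : y < x) :
    (f x - f y) ^ 2 ≤ (x - y) * ∫ t in y..x, deriv f t ^ 2 := by
  have hc : Continuous (deriv f) := hf.continuous_deriv le_rfl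
  have hI : ∫ t in y..x, deriv f t = f x - f y :=
    intervalIntegral.integral_deriv_eq_sub
      (fun t _ => (hf.differentiable one_ne_zero) t) (hc.intervalIntegrable _ _)
  set I := f x - f y
  set m := I / (x - y) with hm
  have hxy : 0 < x - y := sub_pos.2 h
  have h0 : 0 ≤ ∫ t in y..x, (deriv f t - m) ^ 2 :=
    intervalIntegral.integral_nonneg h.le fun t _ => sq_nonneg _
  have h1 : ∫ t in y..x, (deriv f t - m) ^ 2
      = (∫ t in y..x, deriv f t ^ 2) - 2 * m * I + (x - y) * m ^ 2 := by
    have : ∀ t, (deriv f t - m) ^ 2 = deriv f t ^ 2 - 2 * m * deriv f t + m ^ 2 := fun t => by ring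
    simp_rw [this]
    rw [intervalIntegral.integral_add, intervalIntegral.integral_sub,
      intervalIntegral.integral_const_mul, hI, intervalIntegral.integral_const, smul_eq_mul]
    all_goals exact Continuous.intervalIntegrable (by fun_prop) _ _
  have h2 : I = m * (x - y) := by rw [hm]; field_simp
  rw [h1, h2] at h0
  rw [h2]
  nlinarith [mul_nonneg hxy.le h0]

theorem hasDerivAt_gaussianPDFReal_standard (x : ℝ) :
    HasDerivAt (fun x => -gaussianPDFReal 0 1 x) (x * gaussianPDFReal 0 1 x) x := by
  simp only [gaussianPDFReal_def]
  have : HasDerivAt (fun x : ℝ => -(x - 0) ^ 2 / (2 * ((1 : ℝ≥0) : ℝ))) (-x) x := by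
    have := ((((hasDerivAt_id x).sub_const 0).pow 2).neg).div_const (2 * ((1 : ℝ≥0) : ℝ))
    refine this.congr_deriv ?_
    simp
    ring
  refine (this.exp.const_mul _).neg.congr_deriv ?_
  ring

theorem tendsto_gaussianPDFReal_standard_atTop :
    Filter.Tendsto (gaussianPDFReal 0 1) Filter.atTop (nhds 0) := by
  have h : Filter.Tendsto (fun x : ℝ => (Real.sqrt (2 * Real.pi * ((1 : ℝ≥0) : ℝ)))⁻¹ *
      Real.exp (-(x - 0) ^ 2 / (2 * ((1 : ℝ≥0) : ℝ)))) Filter.atTop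
      (nhds ((Real.sqrt (2 * Real.pi * ((1 : ℝ≥0) : ℝ)))⁻¹ * 0)) := by
    refine Filter.Tendsto.const_mul _ (Real.tendsto_exp_atBot.comp ?_)
    have : Filter.Tendsto (fun x : ℝ => x ^ 2 / 2) Filter.atTop Filter.atTop :=
      (Filter.tendsto_pow_atTop two_ne_zero).atTop_div_const two_pos
    refine (Filter.tendsto_neg_atTop_atBot.comp this).congr fun x => ?_
    simp
    ring
  rw [mul_zero] at h
  exact h

theorem setIntegral_Ici_gaussianReal_standard (t : ℝ) :
    ∫ x in Set.Ici t, x ∂gaussianReal 0 1 = gaussianPDFReal 0 1 t := by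
  have hint : Integrable (fun x => x * gaussianPDFReal 0 1 x) := by
    have h := (memLp_id_gaussianReal (μ := 0) (v := 1) 1).integrable le_rfl
    rw [gaussianReal_of_var_ne_zero _ one_ne_zero, integrable_withDensity_iff_integrable_smul'
      (measurable_gaussianPDF _ _) (by simp [gaussianPDF])] at h
    refine h.congr (.of_forall fun x => ?_)
    simp [toReal_gaussianPDF, mul_comm]
  rw [gaussianReal_of_var_ne_zero _ one_ne_zero,
    setIntegral_withDensity_eq_setIntegral_toReal_smul (measurable_gaussianPDF _ _)
      (by simp [gaussianPDF]) _ measurableSet_Ici, integral_Ici_eq_integral_Ioi]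
  have := integral_Ioi_of_hasDerivAt_of_tendsto' (a := t)
    (fun x _ => hasDerivAt_gaussianPDFReal_standard x) hint.integrableOn
    tendsto_gaussianPDFReal_standard_atTop.neg
  simp only [neg_zero, sub_neg_eq_add, zero_add] at this
  rw [← this]
  simp [toReal_gaussianPDF, mul_comm]

theorem setIntegral_Iio_gaussianReal_standard (t : ℝ) :
    ∫ x in Set.Iio t, x ∂gaussianReal 0 1 = -gaussianPDFReal 0 1 t := by
  have h := integral_add_compl (μ := gaussianReal 0 1) (f := fun x => x)
    (measurableSet_Ici (a := t)) ((memLp_id_gaussianReal (μ := 0) (v := 1) 1).integrable le_rfl)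
  rw [integral_id_gaussianReal, setIntegral_Ici_gaussianReal_standard, Set.compl_Ici] at h
  linarith

/-- The Gaussian average of the kernel `1_{y < t ≤ x} (x - y)` is the Gaussian density at `t`. -/
theorem lintegral_lintegral_gaussian_kernel (t : ℝ) :
    ∫⁻ y, ∫⁻ x, (if y < t ∧ t ≤ x then ENNReal.ofReal (x - y) else 0)
      ∂gaussianReal 0 1 ∂gaussianReal 0 1 = gaussianPDF 0 1 t := by
  set γ := gaussianReal 0 1
  have hid : Integrable (fun x : ℝ => x) γ :=
    (memLp_id_gaussianReal (μ := 0) (v := 1) 1).integrable le_rfl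
  have h1 : ∀ y, ∫⁻ x, (if y < t ∧ t ≤ x then ENNReal.ofReal (x - y) else 0) ∂γ
      = (Set.Iio t).indicator (fun y => ∫⁻ x in Set.Ici t, ENNReal.ofReal (x - y) ∂γ) y := by
    intro y
    by_cases hy : y < t
    · rw [Set.indicator_of_mem (show y ∈ Set.Iio t from hy), ← lintegral_indicator measurableSet_Ici]
      refine lintegral_congr fun x => ?_
      simp [hy, Set.indicator_apply]
    · simp [hy]
  simp_rw [h1]
  rw [lintegral_indicator measurableSet_Iio]
  have h2 : ∀ y ∈ Set.Iio t, ∫⁻ x in Set.Ici t, ENNReal.ofReal (x - y) ∂γ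
      = ENNReal.ofReal (gaussianPDFReal 0 1 t - γ.real (Set.Ici t) * y) := by
    intro y hy
    have hsub : Integrable (fun x : ℝ => x - y) (γ.restrict (Set.Ici t)) :=
      hid.integrableOn.sub (integrable_const _)
    rw [← ofReal_integral_eq_lintegral_ofReal hsub,
      integral_sub hid.integrableOn (integrable_const _), setIntegral_Ici_gaussianReal_standard]
    · simp
    · exact (ae_restrict_iff' measurableSet_Ici).2 (.of_forall fun x hx =>
        sub_nonneg.2 ((Set.mem_Iio.1 hy).le.trans hx))
  have h2' : ∀ y ∈ Set.Iio t, 0 ≤ gaussianPDFReal 0 1 t - γ.real (Set.Ici t) * y := by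
    intro y hy
    have : γ.real (Set.Ici t) * y = ∫ x in Set.Ici t, y ∂γ := by simp
    rw [this, ← setIntegral_Ici_gaussianReal_standard, ← integral_sub hid.integrableOn
      (integrable_const _)]
    exact setIntegral_nonneg measurableSet_Ici fun x hx =>
      sub_nonneg.2 ((Set.mem_Iio.1 hy).le.trans hx)
  have hsub : Integrable (fun y => gaussianPDFReal 0 1 t - γ.real (Set.Ici t) * y)
      (γ.restrict (Set.Iio t)) := (integrable_const _).sub (hid.integrableOn.const_mul _)
  rw [setLIntegral_congr_fun measurableSet_Iio h2,
    ← ofReal_integral_eq_lintegral_ofReal hsub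
      ((ae_restrict_iff' measurableSet_Iio).2 (.of_forall h2')),
    integral_sub (integrable_const _) (hid.integrableOn.const_mul _), integral_const_mul,
    setIntegral_Iio_gaussianReal_standard, gaussianPDF]
  have h3 : γ.real (Set.Iio t) + γ.real (Set.Ici t) = 1 := by
    rw [← Set.compl_Iio]
    exact probReal_add_probReal_compl measurableSet_Iio
  congr 1
  simp only [integral_const, measureReal_restrict_apply MeasurableSet.univ, Set.univ_inter,
    smul_eq_mul]
  linear_combination (gaussianPDFReal 0 1 t) * h3

/-- The **Gaussian Poincaré inequality** on the line. -/
theorem evariance_gaussianReal_standard_le {f : ℝ → ℝ} (hf : ContDiff ℝ 1 f)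
    (hint : Integrable f (gaussianReal 0 1)) :
    eVar[f; gaussianReal 0 1] ≤ ∫⁻ t, ENNReal.ofReal (deriv f t ^ 2) ∂gaussianReal 0 1 := by
  set γ := gaussianReal 0 1 with hγ
  have hc : Continuous (deriv f) := hf.continuous_deriv le_rfl
  have hdm : Measurable fun t => ENNReal.ofReal (deriv f t ^ 2) := by
    have := hc.measurable; fun_prop
  -- The weight x - y is the Cauchy-Schwarz factor. Integrating x and y out first turns Lebesgue
  -- measure in t into the Gaussian measure, with constant exactly 1.
  let k : ℝ → ℝ → ℝ → ℝ≥0∞ := fun y x t => if y < t ∧ t ≤ x then ENNReal.ofReal (x - y) else 0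
  have hk : Measurable fun z : ℝ × ℝ × ℝ => k z.1 z.2.1 z.2.2 := by
    refine Measurable.ite ?_ (by fun_prop) measurable_const
    have m1 : MeasurableSet {z : ℝ × ℝ × ℝ | z.1 < z.2.2} :=
      measurableSet_lt (by fun_prop) (by fun_prop)
    have m2 : MeasurableSet {z : ℝ × ℝ × ℝ | z.2.2 ≤ z.2.1} :=
      measurableSet_le (by fun_prop) (by fun_prop)
    exact m1.inter m2
  let K : ℝ → ℝ → ℝ≥0∞ := fun y x => ∫⁻ t, k y x t * ENNReal.ofReal (deriv f t ^ 2)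
  have hK : Measurable fun z : ℝ × ℝ => K z.1 z.2 := by
    refine Measurable.lintegral_prod_right' (f := fun w : (ℝ × ℝ) × ℝ =>
      k w.1.1 w.1.2 w.2 * ENNReal.ofReal (deriv f w.2 ^ 2)) ?_
    exact (hk.comp (g := fun z : ℝ × ℝ × ℝ => k z.1 z.2.1 z.2.2)
      (f := fun w : (ℝ × ℝ) × ℝ => (w.1.1, w.1.2, w.2)) (by fun_prop)).mul (hdm.comp measurable_snd)
  have hlt : ∀ x y, y < x → ENNReal.ofReal ((f x - f y) ^ 2) ≤ K y x := by
    intro x y h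
    have hsq : IntegrableOn (fun t => deriv f t ^ 2) (Set.Ioc y x) := (hc.pow 2).integrableOn_Ioc
    have e : K y x = ENNReal.ofReal ((x - y) * ∫ t in y..x, deriv f t ^ 2) := by
      rw [ENNReal.ofReal_mul (sub_pos.2 h).le, intervalIntegral.integral_of_le h.le,
        ofReal_integral_eq_lintegral_ofReal hsq (.of_forall fun t => sq_nonneg _),
        ← lintegral_const_mul _ hdm, ← lintegral_indicator measurableSet_Ioc]
      refine lintegral_congr fun t => ?_
      simp only [k, Set.indicator_apply, Set.mem_Ioc]
      split_ifs <;> simp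
    rw [e]
    exact ENNReal.ofReal_le_ofReal (sq_sub_le_mul_integral_deriv_sq hf h)
  -- `K y x` vanishes unless y < x, so both orders are added; the resulting factor 2 cancels the one
  -- from the two independent copies.
  have hle : ∀ x y, ENNReal.ofReal ((f x - f y) ^ 2) ≤ K y x + K x y := by
    intro x y
    rcases lt_trichotomy y x with h | rfl | h
    · exact (hlt x y h).trans le_self_add
    · simp
    · rw [sub_sq_comm]
      exact (hlt y x h).trans le_add_self
  have hKint : ∫⁻ y, ∫⁻ x, K y x ∂γ ∂γ = ∫⁻ t, ENNReal.ofReal (deriv f t ^ 2) ∂γ := by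
    have s1 : ∀ y, ∫⁻ x, K y x ∂γ
        = ∫⁻ t, (∫⁻ x, k y x t ∂γ) * ENNReal.ofReal (deriv f t ^ 2) := by
      intro y
      simp only [K]
      have hky : Measurable fun z : ℝ × ℝ => k y z.1 z.2 :=
        hk.comp (measurable_const.prodMk measurable_id)
      rw [lintegral_lintegral_swap]
      · refine lintegral_congr fun t => lintegral_mul_const _ ?_
        exact hky.comp (measurable_id.prodMk measurable_const)
      · exact (hky.mul (hdm.comp measurable_snd)).aemeasurable
    have hkx : Measurable fun z : ℝ × ℝ => ∫⁻ x, k z.1 x z.2 ∂γ := by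
      refine Measurable.lintegral_prod_right' (f := fun w : (ℝ × ℝ) × ℝ => k w.1.1 w.2 w.1.2) ?_
      exact hk.comp (f := fun w : (ℝ × ℝ) × ℝ => (w.1.1, w.2, w.1.2)) (by fun_prop)
    simp_rw [s1]
    rw [lintegral_lintegral_swap]
    · have s2 : ∀ t, ∫⁻ y, (∫⁻ x, k y x t ∂γ) * ENNReal.ofReal (deriv f t ^ 2) ∂γ
          = gaussianPDF 0 1 t * ENNReal.ofReal (deriv f t ^ 2) := by
        intro t
        rw [lintegral_mul_const, lintegral_lintegral_gaussian_kernel]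
        exact hkx.comp (measurable_id.prodMk measurable_const)
      simp_rw [s2]
      rw [hγ, gaussianReal_of_var_ne_zero _ one_ne_zero,
        lintegral_withDensity_eq_lintegral_mul _ (measurable_gaussianPDF _ _) hdm]
      rfl
    · exact (hkx.mul (hdm.comp measurable_snd)).aemeasurable
  have h2 : 2 * eVar[f; γ] ≤ 2 * ∫⁻ t, ENNReal.ofReal (deriv f t ^ 2) ∂γ := by
    rw [← lintegral_lintegral_ofReal_sub_sq hint]
    calc ∫⁻ y, ∫⁻ x, ENNReal.ofReal ((f x - f y) ^ 2) ∂γ ∂γ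
        ≤ ∫⁻ y, ∫⁻ x, (K y x + K x y) ∂γ ∂γ :=
          lintegral_mono fun y => lintegral_mono fun x => hle x y
      _ = ∫⁻ y, ∫⁻ x, K y x ∂γ ∂γ + ∫⁻ y, ∫⁻ x, K x y ∂γ ∂γ := by
          rw [← lintegral_add_left]
          · refine lintegral_congr fun y => lintegral_add_left ?_ _
            exact hK.comp (measurable_const.prodMk measurable_id)
          · exact hK.lintegral_prod_right'
      _ = _ := by
          rw [lintegral_lintegral_swap (f := fun y x => K x y)
            (hK.comp measurable_swap).aemeasurable, hKint, two_mul]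
  exact (ENNReal.mul_le_mul_iff_right two_ne_zero ENNReal.ofNat_ne_top).1 h2

/-! ### The Poincaré inequality for products and for diagonal Gaussians. -/

theorem evariance_map {Ω Ω' : Type*} [MeasurableSpace Ω] [MeasurableSpace Ω'] {μ : Measure Ω}
    {T : Ω → Ω'} (hT : Measurable T) {f : Ω' → ℝ} (hf : Measurable f) :
    eVar[f; μ.map T] = eVar[fun x => f (T x); μ] := by
  rw [evariance_eq_lintegral_ofReal, evariance_eq_lintegral_ofReal,
    lintegral_map (by fun_prop) hT, integral_map hT.aemeasurable hf.aestronglyMeasurable]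

/-- The Gaussian Poincaré inequality for the standard Gaussian measure on `Fin n → ℝ`. -/
theorem evariance_pi_gaussianReal_standard_le {n : ℕ} {f : (Fin n → ℝ) → ℝ} (hf : ContDiff ℝ 1 f)
    (hint : Integrable f (Measure.pi fun _ => gaussianReal 0 1)) :
    eVar[f; Measure.pi fun _ => gaussianReal 0 1] ≤
      ∫⁻ x, ∑ i, ENNReal.ofReal (lineDeriv ℝ f x (Pi.single i 1) ^ 2)
        ∂(Measure.pi fun _ => gaussianReal 0 1) := by
  induction n with
  | zero =>
    have h : ∀ x, f x = f 0 := fun x => congrArg f (Subsingleton.elim _ _)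
    rw [evariance_eq_lintegral_ofReal]
    simp [h]
  | succ n ih =>
    set γ := gaussianReal 0 1
    set π : Measure (Fin n → ℝ) := Measure.pi fun _ => γ
    let T : ℝ × (Fin n → ℝ) → Fin (n + 1) → ℝ := fun z => Fin.cons z.1 z.2
    have hT : MeasurePreserving T (γ.prod π) (Measure.pi fun _ => γ) := by
      have := (measurePreserving_piFinSuccAbove (fun _ : Fin (n + 1) => γ) 0).symm
      convert! this using 1
      ext z : 1
      exact (Fin.insertNth_zero' z.1 z.2).symm
    have hTd : ContDiff ℝ 1 T := by
      refine contDiff_pi.2 fun i => ?_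
      refine Fin.cases ?_ (fun j => ?_) i
      · exact contDiff_fst
      · exact (contDiff_apply ℝ ℝ j).comp contDiff_snd
    have hfT : ContDiff ℝ 1 fun z => f (T z) := hf.comp hTd
    have hintT : Integrable (fun z => f (T z)) (γ.prod π) :=
      (hT.integrable_comp hf.continuous.aestronglyMeasurable).2 hint
    have e0 : ∀ (a : ℝ) (v : Fin n → ℝ),
        deriv (fun a => f (T (a, v))) a = lineDeriv ℝ f (T (a, v)) (Pi.single 0 1) := by
      intro a v
      have h : ∀ t : ℝ, T (a, v) + t • Pi.single 0 1 = T (a + t, v) := by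
        intro t
        ext i
        refine Fin.cases ?_ (fun j => ?_) i <;> simp [T]
      simp only [lineDeriv, h]
      have := deriv_comp_const_add (fun a => f (T (a, v))) a 0
      simp [this]
    have e1 : ∀ (a : ℝ) (v : Fin n → ℝ) (i : Fin n),
        lineDeriv ℝ (fun v => f (T (a, v))) v (Pi.single i 1)
          = lineDeriv ℝ f (T (a, v)) (Pi.single i.succ 1) := by
      intro a v i
      have h : ∀ t : ℝ, T (a, v) + t • Pi.single i.succ 1 = T (a, v + t • Pi.single i 1) := by
        intro t
        ext k
        refine Fin.cases ?_ (fun j => ?_) k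
        · simp [T, (Fin.succ_ne_zero i).symm]
        · simp [T, Pi.single_apply]
      simp only [lineDeriv, h]
    have hm : ∀ i, Measurable fun x => ENNReal.ofReal (lineDeriv ℝ f x (Pi.single i 1) ^ 2) :=
      fun i => ((measurable_lineDeriv hf.continuous).pow_const 2).ennreal_ofReal
    have hmT : ∀ i, Measurable fun z =>
        ENNReal.ofReal (lineDeriv ℝ f (T z) (Pi.single i 1) ^ 2) :=
      fun i => (hm i).comp hT.measurable
    rw [← hT.map_eq, evariance_map hT.measurable hf.continuous.measurable,
      lintegral_map (Finset.measurable_sum _ fun i _ => hm i) hT.measurable]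
    simp_rw [Fin.sum_univ_succ]
    rw [lintegral_add_left (hmT 0), add_comm]
    -- Tensorization leaves the tail coordinates to the induction hypothesis and coordinate 0 to the
    -- inequality on the line.
    refine (evariance_prod_le hfT.continuous.measurable hintT).trans (add_le_add ?_ ?_)
    · rw [lintegral_prod _ (Finset.measurable_sum _ fun i _ => hmT i.succ).aemeasurable]
      refine lintegral_mono_ae ?_
      filter_upwards [hintT.prod_right_ae] with a ha
      refine (ih (hfT.comp (contDiff_const.prodMk contDiff_id)) ha).trans_eq ?_
      simp_rw [← e1]
      rfl
    · rw [lintegral_prod_symm _ (hmT 0).aemeasurable]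
      refine lintegral_mono_ae ?_
      filter_upwards [hintT.prod_left_ae] with v hv
      refine (evariance_gaussianReal_standard_le
        (hfT.comp (contDiff_id.prodMk contDiff_const)) hv).trans_eq ?_
      simp_rw [← e0]
      rfl

/-- Through this affine image the chain rule produces the factors `σ i`, and degenerate coordinates
need no separate case. -/
theorem diagGaussian_eq_map_standard {d : ℕ} (μ : Fin d → ℝ) (σ : Fin d → ℝ≥0) :
    diagGaussian μ σ = (Measure.pi fun _ : Fin d => gaussianReal 0 1).map
      fun z => WithLp.toLp 2 fun i => μ i + σ i * z i := by
  have h : ∀ i, (gaussianReal 0 1).map (fun t => μ i + σ i * t) = gaussianReal (μ i) (σ i ^ 2) := by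
    intro i
    have h1 : (fun t : ℝ => μ i + σ i * t) = (fun t => μ i + t) ∘ fun t => σ i * t := rfl
    rw [h1, ← Measure.map_map (by fun_prop) (by fun_prop), gaussianReal_map_const_mul,
      gaussianReal_map_const_add]
    congr 1
    · simp
    · ext; simp
  have h2 : (Measure.pi fun i => gaussianReal (μ i) (σ i ^ 2))
      = (Measure.pi fun _ : Fin d => gaussianReal 0 1).map fun z i => μ i + σ i * z i := by
    have := Measure.pi_map_pi (μ := fun _ : Fin d => gaussianReal 0 1)
      (f := fun i t => μ i + σ i * t) (fun i => by fun_prop)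
    rw [this]
    simp_rw [h]
  rw [diagGaussian, h2, Measure.map_map (by fun_prop) (by fun_prop)]
  rfl

/-- The Gaussian Poincaré inequality for independent coordinates with standard deviations at most
`s`, zero included. -/
theorem evariance_diagGaussian_le {d : ℕ} (μ : Fin d → ℝ) (σ : Fin d → ℝ≥0) {s : ℝ≥0}
    (hs : ∀ i, σ i ≤ s) {f : EuclideanSpace ℝ (Fin d) → ℝ} (hf : ContDiff ℝ 1 f)
    (hint : Integrable f (diagGaussian μ σ)) :
    eVar[f; diagGaussian μ σ] ≤
      ENNReal.ofReal ((s : ℝ) ^ 2) * ∫⁻ x, ENNReal.ofReal (‖gradient f x‖ ^ 2) ∂diagGaussian μ σ := by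
  let T : (Fin d → ℝ) → EuclideanSpace ℝ (Fin d) := fun z => WithLp.toLp 2 fun i => μ i + σ i * z i
  have hTm : Measurable T := by fun_prop
  have hTd : ContDiff ℝ 1 T := by
    refine (contDiff_euclidean).2 fun i => ?_
    exact contDiff_const.add (contDiff_const.mul (contDiff_apply ℝ ℝ i))
  have hgm : Measurable fun x => ENNReal.ofReal (‖gradient f x‖ ^ 2) := by
    have : Continuous fun x => gradient f x :=
      (InnerProductSpace.toDual ℝ _).symm.continuous.comp (hf.continuous_fderiv one_ne_zero)
    exact (this.norm.measurable.pow_const 2).ennreal_ofReal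
  have hgT : Measurable fun z => ENNReal.ofReal (‖gradient f (T z)‖ ^ 2) := hgm.comp hTm
  rw [diagGaussian_eq_map_standard] at hint ⊢
  rw [evariance_map hTm hf.continuous.measurable, lintegral_map hgm hTm,
    ← lintegral_const_mul _ hgT]
  refine (evariance_pi_gaussianReal_standard_le (hf.comp hTd)
    ((integrable_map_measure hf.continuous.aestronglyMeasurable hTm.aemeasurable).1 hint)).trans
    (lintegral_mono fun z => ?_)
  have e : ∀ i, lineDeriv ℝ (fun z => f (T z)) z (Pi.single i 1) = σ i * gradient f (T z) i := by
    intro i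
    have h : ∀ t : ℝ, T (z + t • Pi.single i 1)
        = T z + t • ((σ i : ℝ) • EuclideanSpace.single i (1 : ℝ)) := by
      intro t
      ext j
      by_cases hj : j = i
      · subst hj; simp [T]; ring
      · simp [T, hj]
    have h1 : lineDeriv ℝ (fun z => f (T z)) z (Pi.single i 1)
        = lineDeriv ℝ f (T z) ((σ i : ℝ) • EuclideanSpace.single i (1 : ℝ)) := by
      simp only [lineDeriv, h]
    rw [h1, ((hf.differentiable one_ne_zero) _).lineDeriv_eq_fderiv, map_smul, smul_eq_mul]
    congr 1
    have := InnerProductSpace.toDual_symm_apply (𝕜 := ℝ)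
      (x := EuclideanSpace.single i (1 : ℝ)) (y := fderiv ℝ f (T z))
    rw [← this, EuclideanSpace.inner_single_right]
    simp [gradient]
  simp only [Function.comp_def, e]
  rw [← ENNReal.ofReal_sum_of_nonneg fun i _ => sq_nonneg _, ← ENNReal.ofReal_mul (sq_nonneg _)]
  refine ENNReal.ofReal_le_ofReal ?_
  rw [EuclideanSpace.norm_sq_eq, Finset.mul_sum]
  refine Finset.sum_le_sum fun i _ => ?_
  rw [mul_pow, Real.norm_eq_abs, sq_abs]
  have := hs i
  gcongr

/-! ### Exponential moments and the Laplace transform near zero. -/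

/-- For u ≤ 0 the function 1 + x + x²/2 - eˣ is decreasing and vanishes at 0. For u ≥ 0 the function
(1 + x)e⁻ˣ + x²/2 is increasing from the value 1; multiplying by eᵘ gives the bound with eᵘ, hence
with e^c. -/
theorem exp_le_one_add_add_sq_mul_exp {u c : ℝ} (hc : 0 ≤ c) (h : u ≤ c) :
    Real.exp u ≤ 1 + u + u ^ 2 * Real.exp c / 2 := by
  rcases le_total u 0 with hu | hu
  · have hd : ∀ x : ℝ, HasDerivAt (fun x => 1 + x + x ^ 2 / 2 - Real.exp x)
        (1 + x - Real.exp x) x := by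
      intro x
      have := (((hasDerivAt_id x).const_add 1).add
        (((hasDerivAt_id x).pow 2).div_const 2)).sub (Real.hasDerivAt_exp x)
      refine this.congr_deriv ?_
      simp
    have hanti : Antitone fun x : ℝ => 1 + x + x ^ 2 / 2 - Real.exp x :=
      antitone_of_deriv_nonpos (fun x => (hd x).differentiableAt) fun x => by
        rw [(hd x).deriv]
        linarith [Real.add_one_le_exp x]
    have h0 := hanti hu
    simp only [Real.exp_zero] at h0
    have h1 : u ^ 2 * 1 ≤ u ^ 2 * Real.exp c := by gcongr; exact Real.one_le_exp hc
    linarith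
  · have hd : ∀ x : ℝ, HasDerivAt (fun x => (1 + x) * Real.exp (-x) + x ^ 2 / 2)
        (x * (1 - Real.exp (-x))) x := by
      intro x
      have := (((hasDerivAt_id x).const_add 1).mul ((hasDerivAt_neg x).exp)).add
        (((hasDerivAt_id x).pow 2).div_const 2)
      refine this.congr_deriv ?_
      simp
      ring
    have hmono : Monotone fun x : ℝ => (1 + x) * Real.exp (-x) + x ^ 2 / 2 :=
      monotone_of_deriv_nonneg (fun x => (hd x).differentiableAt) fun x => by
        rw [(hd x).deriv]
        rcases le_total x 0 with hx | hx
        · exact mul_nonneg_of_nonpos_of_nonpos hx (sub_nonpos.2 (Real.one_le_exp (by linarith)))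
        · exact mul_nonneg hx (sub_nonneg.2 (Real.exp_le_one_iff.2 (by linarith)))
    have h0 := hmono hu
    simp only [neg_zero, Real.exp_zero] at h0
    have h1 : Real.exp u ≤ 1 + u + u ^ 2 * Real.exp u / 2 := by
      have h2 := mul_le_mul_of_nonneg_right h0 (Real.exp_pos u).le
      have h3 : Real.exp (-u) * Real.exp u = 1 := by rw [← Real.exp_add]; simp
      linear_combination h2 + (1 + u) * h3
    have h2 : u ^ 2 * Real.exp u ≤ u ^ 2 * Real.exp c := by gcongr
    linarith

/-- A nonnegative variable with variance at most `V` satisfies a one-sided exponential moment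
bound. -/
theorem integral_exp_mul_integral_sub_le {Ω : Type*} [MeasurableSpace Ω] {D : Measure Ω}
    [IsProbabilityMeasure D] {X : Ω → ℝ} (hX : Integrable X D) (hX0 : ∀ z, 0 ≤ X z)
    {α V : ℝ} (hα : 0 ≤ α) (hα1 : α ≤ 1) (hV : eVar[X; D] ≤ ENNReal.ofReal V) (hV0 : 0 ≤ V) :
    ∫ z, Real.exp (α * (∫ z, X z ∂D - X z)) ∂D
      ≤ Real.exp (α ^ 2 * Real.exp (∫ z, X z ∂D) * V / 2) := by
  set a := ∫ z, X z ∂D with ha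
  have ha0 : 0 ≤ a := integral_nonneg hX0
  have hsq : Integrable (fun z => (X z - a) ^ 2) D := by
    have hsm : AEStronglyMeasurable (fun z => (X z - a) ^ 2) D :=
      (hX.aestronglyMeasurable.sub aestronglyMeasurable_const).pow 2
    rw [← lintegral_ofReal_ne_top_iff_integrable hsm (.of_forall fun z => sq_nonneg _), ha, ← evariance_eq_lintegral_ofReal]
    exact (hV.trans_lt ENNReal.ofReal_lt_top).ne
  have hsqV : ∫ z, (X z - a) ^ 2 ∂D ≤ V := by
    rw [evariance_eq_lintegral_ofReal,
      ← ofReal_integral_eq_lintegral_ofReal hsq (.of_forall fun z => sq_nonneg _)] at hV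
    exact (ENNReal.ofReal_le_ofReal_iff hV0).1 hV
  have hsub : Integrable (fun z => α * (a - X z)) D := ((integrable_const _).sub hX).const_mul _
  have hlin : Integrable (fun z => 1 + α * (a - X z)) D := (integrable_const _).add hsub
  have hquad : Integrable (fun z => α ^ 2 * Real.exp a / 2 * (X z - a) ^ 2) D := hsq.const_mul _
  calc ∫ z, Real.exp (α * (a - X z)) ∂D
      ≤ ∫ z, (1 + α * (a - X z) + α ^ 2 * Real.exp a / 2 * (X z - a) ^ 2) ∂D := by
        refine integral_mono_of_nonneg (.of_forall fun z => (Real.exp_pos _).le)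
          (hlin.add hquad) (.of_forall fun z => ?_)
        -- Nonnegativity of `X` and α ≤ 1 enter here, giving the ceiling for the quadratic bound.
        have h1 : α * (a - X z) ≤ a := by nlinarith [hX0 z, mul_nonneg hα (hX0 z)]
        refine (exp_le_one_add_add_sq_mul_exp ha0 h1).trans_eq ?_
        ring
    _ = 1 + α ^ 2 * Real.exp a / 2 * ∫ z, (X z - a) ^ 2 ∂D := by
        rw [integral_add hlin hquad, integral_const_mul, integral_add (integrable_const _) hsub,
          integral_const_mul, integral_sub (integrable_const _) hX]
        simp [← ha]
    _ ≤ 1 + α ^ 2 * Real.exp a / 2 * V := by gcongr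
    _ ≤ Real.exp (α ^ 2 * Real.exp a * V / 2) := by
        have := Real.add_one_le_exp (α ^ 2 * Real.exp a * V / 2)
        linarith

/-- The difference quotients lie between X - αX²/2 and X, so they converge pointwise and are
dominated by X; no second moment is needed. -/
theorem tendsto_one_sub_integral_exp_neg_mul_div {Ω : Type*} [MeasurableSpace Ω] {N : Measure Ω}
    [IsProbabilityMeasure N] {X : Ω → ℝ} (hX : Integrable X N) (hX0 : ∀ z, 0 ≤ X z)
    {α : ℕ → ℝ} (hα : ∀ n, 0 < α n) (hα0 : Filter.Tendsto α Filter.atTop (nhds 0)) :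
    Filter.Tendsto (fun n => (1 - ∫ z, Real.exp (-α n * X z) ∂N) / α n) Filter.atTop
      (nhds (∫ z, X z ∂N)) := by
  have hm : ∀ n, AEStronglyMeasurable (fun z => Real.exp (-α n * X z)) N := fun n =>
    Real.continuous_exp.comp_aestronglyMeasurable (hX.aestronglyMeasurable.const_mul _)
  have hi : ∀ n, Integrable (fun z => Real.exp (-α n * X z)) N := fun n => by
    refine (integrable_const (1 : ℝ)).mono' (hm n) (.of_forall fun z => ?_)
    rw [Real.norm_eq_abs, Real.abs_exp, Real.exp_le_one_iff]
    nlinarith [mul_nonneg (hα n).le (hX0 z)]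
  have hle : ∀ n z, (1 - Real.exp (-α n * X z)) / α n ≤ X z := fun n z => by
    rw [div_le_iff₀ (hα n)]
    have := Real.add_one_le_exp (-α n * X z)
    linarith
  have hge : ∀ n z, X z - α n * X z ^ 2 / 2 ≤ (1 - Real.exp (-α n * X z)) / α n := fun n z => by
    rw [le_div_iff₀ (hα n)]
    have h0 : -α n * X z ≤ 0 := by nlinarith [mul_nonneg (hα n).le (hX0 z)]
    have := exp_le_one_add_add_sq_mul_exp le_rfl h0
    rw [Real.exp_zero] at this
    linarith
  have heq : ∀ n, (1 - ∫ z, Real.exp (-α n * X z) ∂N) / α n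
      = ∫ z, (1 - Real.exp (-α n * X z)) / α n ∂N := fun n => by
    rw [integral_div, integral_sub (integrable_const _) (hi n)]
    simp
  simp_rw [heq]
  refine tendsto_integral_of_dominated_convergence X
    (fun n => (((integrable_const _).sub (hi n)).div_const _).aestronglyMeasurable) hX
    (fun n => .of_forall fun z => ?_) (.of_forall fun z => ?_)
  · rw [Real.norm_eq_abs, abs_of_nonneg]
    · exact hle n z
    · refine div_nonneg (sub_nonneg.2 (Real.exp_le_one_iff.2 ?_)) (hα n).le
      nlinarith [mul_nonneg (hα n).le (hX0 z)]
  · refine tendsto_of_tendsto_of_tendsto_of_le_of_le ?_ tendsto_const_nhds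
      (fun n => hge n z) (fun n => hle n z)
    have := ((hα0.mul_const (X z ^ 2)).div_const 2).const_sub (X z)
    simpa using this

/-! ### Variance of a Gaussian mixture. -/

section Mixture

variable {d : ℕ} {Y : Type*} [MeasurableSpace Y] (P : PMF Y)
  (μ : Y → Fin d → ℝ) (σ : Y → Fin d → ℝ≥0)

theorem lintegral_gaussianMixture {F : EuclideanSpace ℝ (Fin d) × Y → ℝ≥0∞} (hF : Measurable F) :
    ∫⁻ z, F z ∂gaussianMixture P μ σ
      = ∑' y, P y * ∫⁻ x, F (x, y) ∂diagGaussian (μ y) (σ y) := by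
  rw [gaussianMixture, lintegral_sum_measure]
  refine tsum_congr fun y => ?_
  rw [lintegral_smul_measure, lintegral_map hF (by fun_prop), smul_eq_mul]

theorem integrable_diagGaussian_of_integrable_gaussianMixture
    {F : EuclideanSpace ℝ (Fin d) × Y → ℝ} (hF : Integrable F (gaussianMixture P μ σ)) {y : Y}
    (hy : P y ≠ 0) : Integrable (fun x => F (x, y)) (diagGaussian (μ y) (σ y)) := by
  have h1 : Integrable F (P y • (diagGaussian (μ y) (σ y)).map fun x => (x, y)) :=
    hF.mono_measure (Measure.le_sum (fun y => P y • (diagGaussian (μ y) (σ y)).map fun x => (x, y)) y)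
  exact ((integrable_smul_measure hy (P.apply_ne_top y)).1 h1).comp_measurable (by fun_prop)

theorem integral_gaussianMixture_of_forall_eq {F : EuclideanSpace ℝ (Fin d) × Y → ℝ}
    (hFm : Measurable F) (hF : Integrable F (gaussianMixture P μ σ)) {a : ℝ}
    (ha : ∀ y, P y ≠ 0 → ∫ x, F (x, y) ∂diagGaussian (μ y) (σ y) = a) :
    ∫ z, F z ∂gaussianMixture P μ σ = a := by
  rw [gaussianMixture] at hF ⊢
  rw [integral_sum_measure hF]
  have h1 : ∀ y, ∫ z, F z ∂(P y • (diagGaussian (μ y) (σ y)).map fun x => (x, y))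
      = (P y).toReal * a := fun y => by
    rw [integral_smul_measure, integral_map (by fun_prop) hFm.aestronglyMeasurable, smul_eq_mul]
    by_cases hy : P y = 0
    · simp [hy]
    · rw [ha y hy]
  simp_rw [h1]
  rw [tsum_mul_right, ← ENNReal.tsum_toReal_eq P.apply_ne_top, P.tsum_coe]
  simp

/-- The Poincaré inequality for a Gaussian mixture and a function whose means given the labels all
agree. -/
theorem evariance_gaussianMixture_le [Countable Y] [DiscreteMeasurableSpace Y] {s : ℝ≥0}
    (hσ : ∀ y i, σ y i ≤ s) {F : EuclideanSpace ℝ (Fin d) → Y → ℝ}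
    (hFm : Measurable fun z : EuclideanSpace ℝ (Fin d) × Y => F z.1 z.2)
    (hF : ∀ y, ContDiff ℝ 1 fun x => F x y)
    (hint : Integrable (fun z => F z.1 z.2) (gaussianMixture P μ σ))
    {a : ℝ} (ha : ∀ y, P y ≠ 0 → ∫ x, F x y ∂diagGaussian (μ y) (σ y) = a) :
    eVar[fun z => F z.1 z.2; gaussianMixture P μ σ] ≤ ENNReal.ofReal ((s : ℝ) ^ 2) *
      ∫⁻ z, ENNReal.ofReal (‖gradient (fun x => F x z.2) z.1‖ ^ 2) ∂gaussianMixture P μ σ := by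
  have hgm : Measurable fun z : EuclideanSpace ℝ (Fin d) × Y =>
      ENNReal.ofReal (‖gradient (fun x => F x z.2) z.1‖ ^ 2) := by
    refine measurable_from_prod_countable_left fun y => ?_
    have : Continuous fun x => gradient (fun x => F x y) x :=
      (InnerProductSpace.toDual ℝ _).symm.continuous.comp ((hF y).continuous_fderiv one_ne_zero)
    exact (this.norm.measurable.pow_const 2).ennreal_ofReal
  -- The global mean equals each label's mean, so there is no between-label term and the variance is
  -- the weighted sum of the conditional variances.
  rw [evariance_eq_lintegral_ofReal, integral_gaussianMixture_of_forall_eq P μ σ hFm hint ha,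
    lintegral_gaussianMixture P μ σ (by fun_prop), lintegral_gaussianMixture P μ σ hgm,
    ← ENNReal.tsum_mul_left]
  refine ENNReal.tsum_le_tsum fun y => ?_
  by_cases hy : P y = 0
  · simp [hy]
  have h := evariance_diagGaussian_le (μ y) (σ y) (hσ y) (hF y)
    (integrable_diagGaussian_of_integrable_gaussianMixture P μ σ hint hy)
  rw [evariance_eq_lintegral_ofReal, ha y hy] at h
  rw [mul_left_comm]
  gcongr

end Mixture

/-! ### Change of measure and the PAC-Bayes bound. -/

/-- The Donsker-Varadhan inequality. -/
theorem integral_le_toReal_klDiv_add_log {W : Type*} [MeasurableSpace W] {q p : Measure W}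
    [IsProbabilityMeasure q] [IsProbabilityMeasure p] (h : klDiv q p ≠ ∞) {F : W → ℝ}
    (hFq : Integrable F q) (hFp : Integrable (fun w => Real.exp (F w)) p) :
    ∫ w, F w ∂q ≤ (klDiv q p).toReal + Real.log (∫ w, Real.exp (F w) ∂p) := by
  obtain ⟨hac, hllr⟩ := klDiv_ne_top_iff.1 h
  -- The inequality is the nonnegativity of the divergence of `q` from `p` tilted by `F`.
  have := isProbabilityMeasure_tilted hFp
  have hac' : q ≪ p.tilted F := hac.trans (absolutelyContinuous_tilted hFp)
  have h0 := integral_llr_add_sub_measure_univ_nonneg hac'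
    (integrable_llr_tilted_right hac hFq hllr hFp)
  rw [integral_llr_tilted_right hac hFq hFp hllr] at h0
  rw [toReal_klDiv_of_measure_eq hac (by simp)]
  simp only [probReal_univ] at h0
  linarith

/-- A **PAC-Bayes bound** for nonnegative losses with bounded risk and controlled exponential
moments. -/
theorem exists_measurableSet_forall_lintegral_risk_le {W X Y : Type*} [MeasurableSpace W]
    [MeasurableSpace X] [MeasurableSpace Y] {m : ℕ} (hm : 0 < m) (D : Measure (X × Y))
    [IsProbabilityMeasure D] (ℓ : W → X → Y → ℝ)
    (hmeas : Measurable fun z : W × X × Y => ℓ z.1 z.2.1 z.2.2) (hnonneg : ∀ w x y, 0 ≤ ℓ w x y)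
    {b lam C δ : ℝ} (hb : ∀ w, risk ℓ D w ≤ b) (hlam : 0 < lam) (hC0 : 0 ≤ C)
    (hC : ∀ w, ∫ z, Real.exp (lam / m * (risk ℓ D w - ℓ w z.1 z.2)) ∂D ≤ Real.exp (C / m))
    (hδ : δ ∈ Set.Ioo (0 : ℝ) 1) (p : Measure W) [IsProbabilityMeasure p] :
    ∃ G : Set (Fin m → X × Y), MeasurableSet G ∧
      ENNReal.ofReal (1 - δ) ≤ Measure.pi (fun _ : Fin m => D) G ∧
      ∀ S ∈ G, ∀ q : Measure W, IsProbabilityMeasure q →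
        ∫⁻ w, ENNReal.ofReal (risk ℓ D w) ∂q ≤ ∫⁻ w, ENNReal.ofReal (empiricalRisk ℓ S w) ∂q +
          (ENNReal.ofReal C + klDiv q p + ENNReal.ofReal (Real.log (1 / δ))) /
            ENNReal.ofReal lam := by
  have hm' : (0 : ℝ) < m := Nat.cast_pos.2 hm
  have hR : Measurable (risk ℓ D) := by
    have : StronglyMeasurable fun z : W × X × Y => ℓ z.1 z.2.1 z.2.2 := hmeas.stronglyMeasurable
    exact this.integral_prod_right'.measurable
  have hR0 : ∀ w, 0 ≤ risk ℓ D w := fun w => integral_nonneg fun z => hnonneg _ _ _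
  have hE : Measurable fun z : (Fin m → X × Y) × W => empiricalRisk ℓ z.1 z.2 := by
    refine Measurable.const_mul (Finset.measurable_sum _ fun i _ => ?_) _
    exact hmeas.comp (f := fun z : (Fin m → X × Y) × W => (z.2, (z.1 i).1, (z.1 i).2))
      (by fun_prop)
  have hE0 : ∀ S w, 0 ≤ empiricalRisk ℓ S w := fun S w =>
    mul_nonneg (by positivity) (Finset.sum_nonneg fun i _ => hnonneg _ _ _)
  let F : (Fin m → X × Y) → W → ℝ := fun S w => lam * (risk ℓ D w - empiricalRisk ℓ S w)
  have hF : Measurable fun z : (Fin m → X × Y) × W => F z.1 z.2 :=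
    ((hR.comp measurable_snd).sub hE).const_mul lam
  have hFb : ∀ S w, F S w ≤ lam * b := fun S w => by
    have := hb w
    have := hE0 S w
    exact mul_le_mul_of_nonneg_left (by linarith) hlam.le
  have hexpF : Measurable fun z : (Fin m → X × Y) × W => ENNReal.ofReal (Real.exp (F z.1 z.2)) :=
    (Real.measurable_exp.comp hF).ennreal_ofReal
  let Φ : (Fin m → X × Y) → ℝ≥0∞ := fun S => ∫⁻ w, ENNReal.ofReal (Real.exp (F S w)) ∂p
  have hΦ : Measurable Φ := hexpF.lintegral_prod_right'
  have hmoment : ∀ w, ∫⁻ S, ENNReal.ofReal (Real.exp (F S w)) ∂(Measure.pi fun _ : Fin m => D)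
      ≤ ENNReal.ofReal (Real.exp C) := by
    intro w
    have hFw : Measurable fun S => F S w := hF.comp (measurable_id.prodMk measurable_const)
    rw [← ofReal_integral_eq_lintegral_ofReal _ (.of_forall fun S => (Real.exp_pos _).le)]
    · refine ENNReal.ofReal_le_ofReal ?_
      have h1 : ∀ S, Real.exp (F S w)
          = ∏ i, Real.exp (lam / m * (risk ℓ D w - ℓ w (S i).1 (S i).2)) := fun S => by
        rw [← Real.exp_sum]
        congr 1
        simp only [F, empiricalRisk]
        rw [← Finset.mul_sum, Finset.sum_sub_distrib]
        simp only [Finset.sum_const, Finset.card_univ, Fintype.card_fin, nsmul_eq_mul]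
        field_simp
      simp_rw [h1]
      rw [integral_fintype_prod_eq_prod (μ := fun _ => D)
        (fun (_ : Fin m) (z : X × Y) => Real.exp (lam / m * (risk ℓ D w - ℓ w z.1 z.2)))]
      rw [Finset.prod_const, Finset.card_univ, Fintype.card_fin]
      refine (pow_le_pow_left₀ (integral_nonneg fun z => (Real.exp_pos _).le) (hC w) m).trans_eq ?_
      rw [← Real.exp_nat_mul]
      congr 1
      field_simp
    · refine (integrable_const (Real.exp (lam * b))).mono'
        (Real.measurable_exp.comp hFw).aestronglyMeasurable (.of_forall fun S => ?_)
      rw [Real.norm_eq_abs, Real.abs_exp]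
      exact Real.exp_le_exp.2 (hFb S w)
  have hΦint : ∫⁻ S, Φ S ∂(Measure.pi fun _ : Fin m => D) ≤ ENNReal.ofReal (Real.exp C) := by
    rw [lintegral_lintegral_swap hexpF.aemeasurable]
    refine (lintegral_mono hmoment).trans_eq ?_
    simp
  -- The Markov threshold for failure probability δ; its logarithm is C + log(1/δ).
  set K : ℝ := Real.exp C / δ with hK
  have hK0 : 0 < K := div_pos (Real.exp_pos _) hδ.1
  have hG : MeasurableSet {S | Φ S ≤ ENNReal.ofReal K} := measurableSet_le hΦ measurable_const
  refine ⟨{S | Φ S ≤ ENNReal.ofReal K}, hG, ?_, ?_⟩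
  · have h1 : Measure.pi (fun _ : Fin m => D) {S | Φ S ≤ ENNReal.ofReal K}ᶜ ≤ ENNReal.ofReal δ := by
      calc Measure.pi (fun _ : Fin m => D) {S | Φ S ≤ ENNReal.ofReal K}ᶜ
          ≤ Measure.pi (fun _ : Fin m => D) {S | ENNReal.ofReal K ≤ Φ S} :=
            by
            refine measure_mono fun S hS => ?_
            have h : ¬ Φ S ≤ ENNReal.ofReal K := hS
            exact (not_le.1 h).le
        _ ≤ (∫⁻ S, Φ S ∂(Measure.pi fun _ : Fin m => D)) / ENNReal.ofReal K :=
            meas_ge_le_lintegral_div hΦ.aemeasurable (by simpa using hK0) ENNReal.ofReal_ne_top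
        _ ≤ ENNReal.ofReal (Real.exp C) / ENNReal.ofReal K := by gcongr
        _ = ENNReal.ofReal δ := by
            rw [← ENNReal.ofReal_div_of_pos hK0, hK]
            congr 1
            have := (Real.exp_pos C).ne'
            have := hδ.1.ne'
            field_simp
    rw [← compl_compl {S | Φ S ≤ ENNReal.ofReal K}, prob_compl_eq_one_sub hG.compl,
      ENNReal.ofReal_sub _ hδ.1.le, ENNReal.ofReal_one]
    gcongr
  · intro S hS q hq
    -- If the divergence or the empirical term is infinite, so is the right-hand side; otherwise
    -- everything reduces to real numbers.
    by_cases hkl : klDiv q p = ∞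
    · simp [hkl, ENNReal.top_div]
    by_cases hEtop : ∫⁻ w, ENNReal.ofReal (empiricalRisk ℓ S w) ∂q = ∞
    · simp [hEtop]
    have hES : Measurable (empiricalRisk ℓ S) := hE.comp (measurable_const.prodMk measurable_id)
    have hEi : Integrable (empiricalRisk ℓ S) q :=
      (lintegral_ofReal_ne_top_iff_integrable hES.aestronglyMeasurable
        (.of_forall fun w => hE0 S w)).1 hEtop
    have hRi : Integrable (risk ℓ D) q := by
      refine (integrable_const b).mono' hR.aestronglyMeasurable (.of_forall fun w => ?_)
      rw [Real.norm_eq_abs, abs_of_nonneg (hR0 w)]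
      exact hb w
    have hFq : Integrable (F S) q := (hRi.sub hEi).const_mul lam
    have hFm : Measurable (F S) := hF.comp (measurable_const.prodMk measurable_id)
    have hFp : Integrable (fun w => Real.exp (F S w)) p := by
      have hsm : Measurable fun w => Real.exp (F S w) := Real.measurable_exp.comp hFm
      rw [← lintegral_ofReal_ne_top_iff_integrable hsm.aestronglyMeasurable
        (.of_forall fun w => (Real.exp_pos _).le)]
      exact (lt_of_le_of_lt hS ENNReal.ofReal_lt_top).ne
    have hle : ∫ w, Real.exp (F S w) ∂p ≤ K := by
      have h : Φ S ≤ ENNReal.ofReal K := hS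
      simp only [Φ] at h
      rw [← ofReal_integral_eq_lintegral_ofReal hFp (.of_forall fun w => (Real.exp_pos _).le)] at h
      exact (ENNReal.ofReal_le_ofReal_iff hK0.le).1 h
    have hlog : Real.log (∫ w, Real.exp (F S w) ∂p) ≤ C + Real.log (1 / δ) := by
      refine (Real.log_le_log (integral_exp_pos hFp) hle).trans_eq ?_
      rw [hK, Real.log_div (Real.exp_pos _).ne' hδ.1.ne', Real.log_exp, one_div, Real.log_inv]
      ring
    have hDV := integral_le_toReal_klDiv_add_log hkl hFq hFp
    have hFint : ∫ w, F S w ∂q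
        = lam * (∫ w, risk ℓ D w ∂q - ∫ w, empiricalRisk ℓ S w ∂q) := by
      simp only [F]
      rw [integral_const_mul, integral_sub hRi hEi]
    have hlogδ : 0 ≤ Real.log (1 / δ) :=
      Real.log_nonneg (by rw [one_div]; exact (one_le_inv₀ hδ.1).2 hδ.2.le)
    rw [← ofReal_integral_eq_lintegral_ofReal hRi (.of_forall hR0),
      ← ofReal_integral_eq_lintegral_ofReal hEi (.of_forall (hE0 S)),
      ← ENNReal.ofReal_toReal hkl, ← ENNReal.ofReal_add hC0 ENNReal.toReal_nonneg,
      ← ENNReal.ofReal_add (by positivity) hlogδ, ← ENNReal.ofReal_div_of_pos hlam,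
      ← ENNReal.ofReal_add (integral_nonneg (hE0 S)) (by positivity)]
    refine ENNReal.ofReal_le_ofReal ?_
    rw [← sub_le_iff_le_add', le_div_iff₀ hlam]
    linarith

/-! ### The bound for Gaussian mixtures. -/

theorem mainTheorem1 {W Y : Type*} [MeasurableSpace W]
    [Countable Y] [MeasurableSpace Y] [DiscreteMeasurableSpace Y] {d m : ℕ}
    -- the data distribution: a Gaussian mixture, all standard deviations at most `σmax`
    (P : PMF Y) (μ : Y → Fin d → ℝ) (σ : Y → Fin d → ℝ≥0) (σmax : ℝ≥0)
    (hσ : ∀ y i, σ y i ≤ σmax)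
    -- the loss: measurable, nonnegative, continuously differentiable in `x`
    (ℓ : W → EuclideanSpace ℝ (Fin d) → Y → ℝ)
    (hmeas : Measurable fun z : W × EuclideanSpace ℝ (Fin d) × Y => ℓ z.1 z.2.1 z.2.2)
    (hnonneg : ∀ w x y, 0 ≤ ℓ w x y)
    (hsmooth : ∀ w y, ContDiff ℝ 1 fun x => ℓ w x y)
    -- on-average boundedness of the loss and of its squared gradient norm
    (b g : ℝ)
    (hint : ∀ w, Integrable (fun z => ℓ w z.1 z.2) (gaussianMixture P μ σ))
    (hb : ∀ w, ∫ z, ℓ w z.1 z.2 ∂(gaussianMixture P μ σ) ≤ b)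
    (hgint : ∀ w, Integrable (fun z => ‖gradient (fun x => ℓ w x z.2) z.1‖ ^ 2)
      (gaussianMixture P μ σ))
    (hg : ∀ w, ∫ z, ‖gradient (fun x => ℓ w x z.2) z.1‖ ^ 2 ∂(gaussianMixture P μ σ) ≤ g)
    (lam : ℝ) (hlam : 0 < lam) (hlam_le : lam ≤ m)
    -- per-label balance of the loss
    (hbal : ∀ w, ∀ α ∈ Set.Icc (0 : ℝ) (lam / m), ∃ c : ℝ, ∀ y,
      ∫ x, Real.exp (-α * ℓ w x y) ∂(diagGaussian (μ y) (σ y)) = c)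
    (δ : ℝ) (hδ : δ ∈ Set.Ioo (0 : ℝ) 1)
    -- the prior
    (p : Measure W) [IsProbabilityMeasure p] :
    ∃ G : Set (Fin m → EuclideanSpace ℝ (Fin d) × Y), MeasurableSet G ∧
      ENNReal.ofReal (1 - δ) ≤ Measure.pi (fun _ : Fin m => gaussianMixture P μ σ) G ∧
      ∀ S ∈ G, ∀ q : Measure W, IsProbabilityMeasure q →
        ∫⁻ w, ENNReal.ofReal (risk ℓ (gaussianMixture P μ σ) w) ∂q ≤
          ∫⁻ w, ENNReal.ofReal (empiricalRisk ℓ S w) ∂q +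
            (ENNReal.ofReal (lam ^ 2 * Real.exp b * g * (σmax : ℝ) ^ 2 / (2 * m)) +
              klDiv q p + ENNReal.ofReal (Real.log (1 / δ))) / ENNReal.ofReal lam := by
  have hm' : (0 : ℝ) < m := hlam.trans_le hlam_le
  have hm : 0 < m := Nat.cast_pos.1 hm'
  have hα : 0 < lam / m := div_pos hlam hm'
  -- A point of `W` is needed to deduce g ≥ 0 from the gradient bound.
  obtain ⟨w₀⟩ : Nonempty W := nonempty_of_isProbabilityMeasure p
  have hg0 : 0 ≤ g := (integral_nonneg fun z => sq_nonneg _).trans (hg w₀)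
  have hlm : ∀ w, Measurable fun z : EuclideanSpace ℝ (Fin d) × Y => ℓ w z.1 z.2 := fun w =>
    hmeas.comp (measurable_const.prodMk measurable_id)
  -- Restricted to labels of positive weight, since integrability under the mixture says nothing
  -- about the others.
  have hmean : ∀ w y y', P y ≠ 0 → P y' ≠ 0 → ∫ x, ℓ w x y ∂diagGaussian (μ y) (σ y)
      = ∫ x, ℓ w x y' ∂diagGaussian (μ y') (σ y') := by
    intro w y y' hy hy'
    -- A positive null sequence inside the range [0, λ/m] where balance is assumed.
    let α : ℕ → ℝ := fun n => lam / m * (1 / (n + 1))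
    have hα1 : ∀ n, 0 < α n := fun n => by positivity
    have hα0 : Filter.Tendsto α Filter.atTop (nhds 0) := by
      simpa [α] using tendsto_one_div_add_atTop_nhds_zero_nat.const_mul (lam / m)
    have hlim : ∀ y, P y ≠ 0 → _ := fun y hy => tendsto_one_sub_integral_exp_neg_mul_div
      (integrable_diagGaussian_of_integrable_gaussianMixture P μ σ (hint w) hy)
      (fun x => hnonneg w x y) hα1 hα0
    refine tendsto_nhds_unique (hlim y hy) ((hlim y' hy').congr fun n => ?_)
    have hn : α n ≤ lam / m := by
      refine mul_le_of_le_one_right hα.le ?_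
      rw [div_le_one (by positivity)]
      linarith [(Nat.cast_nonneg n : (0 : ℝ) ≤ n)]
    obtain ⟨c, hc⟩ := hbal w (α n) ⟨(hα1 n).le, hn⟩
    simp only [hc]
  obtain ⟨y₀, hy₀⟩ := P.support_nonempty
  rw [PMF.mem_support_iff] at hy₀
  have hvar : ∀ w, eVar[fun z : EuclideanSpace ℝ (Fin d) × Y => ℓ w z.1 z.2; gaussianMixture P μ σ]
      ≤ ENNReal.ofReal ((σmax : ℝ) ^ 2 * g) := by
    intro w
    refine (evariance_gaussianMixture_le P μ σ hσ (hlm w) (hsmooth w) (hint w)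
      (fun y hy => hmean w y y₀ hy hy₀)).trans ?_
    rw [← ofReal_integral_eq_lintegral_ofReal (hgint w) (.of_forall fun z => sq_nonneg _),
      ← ENNReal.ofReal_mul (sq_nonneg _)]
    refine ENNReal.ofReal_le_ofReal ?_
    have := hg w
    gcongr
  refine exists_measurableSet_forall_lintegral_risk_le hm (gaussianMixture P μ σ) ℓ hmeas hnonneg
    hb hlam (by positivity) (fun w => ?_) hδ p
  refine (integral_exp_mul_integral_sub_le (hint w) (fun z => hnonneg _ _ _) hα.le
    ((div_le_one hm').2 hlam_le) (hvar w) (by positivity)).trans (Real.exp_le_exp.2 ?_)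
  calc (lam / m) ^ 2 * Real.exp (∫ z, ℓ w z.1 z.2 ∂gaussianMixture P μ σ) * ((σmax : ℝ) ^ 2 * g) / 2
      ≤ (lam / m) ^ 2 * Real.exp b * ((σmax : ℝ) ^ 2 * g) / 2 := by
        have := hb w
        gcongr
    _ = lam ^ 2 * Real.exp b * g * (σmax : ℝ) ^ 2 / (2 * m) / m := by
        field_simp
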